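/- All graphs are finite and simple. For a graph $G$ and an integer $k\ge 0$, a stable $k$-partition of $G$ is a multiset $P=\{V_1,\dots,V_k\}$ of $k$ independent sets of $G$, some of which may be empty, such that every vertex of $G$ lies in exactly one $V_i$. For $v\in V(G)$ put $P-v=\{V_1\setminus\{v\},\dots,V_k\setminus\{v\}\}$, as a multiset of $k$ sets. The Bell $k$-coloring multigraph of $G$, denoted $\mathcal{B}^{\mathrm{multi}}_k(G)$, is the loopless multigraph whose vertices are the stable $k$-partitions of $G$, and in which two distinct stable $k$-partitions $P,P'$ are joined by one edge for each vertex $v\in V(G)$ with $P-v=P'-v$. An isomorphism of multigraphs is a bijection of the vertices together with a bijection of the edges that preserves and reflects incidence. A vertex of $G$ is universal if it is adjacent to every other vertex of $G$, and the core of $G$ is the subgraph of $G$ induced on the set of non-universal vertices. Theorem. Let $G_1$ and $G_2$ be graphs of orders $n_1=|V(G_1)|$ and $n_2=|V(G_2)|$. If $\mathcal{B}^{\mathrm{multi}}_{n_1}(G_1)\cong\mathcal{B}^{\mathrm{multi}}_{n_2}(G_2)$, then the cores of $G_1$ and $G_2$ are isomorphic. -/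

import Mathlib

namespace BellColoring

/-- `P` is a stable `k`-partition of `G`: a multiset of `k` independent sets of `G`, empty ones
allowed, such that each vertex of `G` lies in exactly one of them (counted with multiplicity). -/
structure IsStablePartition {V : Type*} [DecidableEq V] (G : SimpleGraph V) (k : ℕ)
    (P : Multiset (Finset V)) : Prop where
  card_eq : Multiset.card P = k
  indep : ∀ A ∈ P, G.IsIndepSet (A : Set V)
  partition : ∀ v : V, P.countP (fun A => v ∈ A) = 1

/-- `P - v`: the multiset of parts of `P`, with the vertex `v` removed from each of them. -/
def removeVertex {V : Type*} [DecidableEq V] (P : Multiset (Finset V)) (v : V) :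
    Multiset (Finset V) :=
  P.map (fun A => A.erase v)

/-- The Bell `k`-coloring multigraph of `G`. Its vertices are the stable `k`-partitions of `G`.
Two distinct stable partitions `P` and `P'` are joined by one edge, labelled `(s(P, P'), v)`,
for each vertex `v` of `G` with `P - v = P' - v`. There are no loops. -/
def bellMultigraph {V : Type*} [DecidableEq V] (k : ℕ) (G : SimpleGraph V) :
    Graph (Multiset (Finset V)) (Sym2 (Multiset (Finset V)) × V) where
  vertexSet := {P | IsStablePartition G k P}
  IsLink e P P' := e.1 = s(P, P') ∧ IsStablePartition G k P ∧ IsStablePartition G k P' ∧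
    P ≠ P' ∧ removeVertex P e.2 = removeVertex P' e.2
  isLink_symm := by
    intro e _
    refine ⟨fun P P' h => ?_⟩
    obtain ⟨he, hP, hP', hne, hv⟩ := h
    exact ⟨he.trans Sym2.eq_swap, hP', hP, hne.symm, hv.symm⟩
  eq_or_eq_of_isLink_of_isLink := by
    intro e x y v w h h'
    have hs : s(x, y) = s(v, w) := h.1.symm.trans h'.1
    rcases Sym2.eq_iff.1 hs with h1 | h1
    · exact Or.inl h1.1
    · exact Or.inr h1.1
  left_mem_of_isLink := by
    intro e x y h
    exact h.2.1

/-- An isomorphism of multigraphs: a bijection of the vertices together with a bijection of the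
edges that preserves and reflects incidence. -/
structure MultigraphIso {α β α' β' : Type*} (M : Graph α β) (M' : Graph α' β') where
  vertexEquiv : M.vertexSet ≃ M'.vertexSet
  edgeEquiv : M.edgeSet ≃ M'.edgeSet
  isLink_iff : ∀ (e : M.edgeSet) (x y : M.vertexSet),
    M'.IsLink (edgeEquiv e) (vertexEquiv x) (vertexEquiv y) ↔ M.IsLink e x y

/-- The core of `G`: the subgraph induced on the vertices that are not universal, a vertex being
universal if it is adjacent to every other vertex. -/
def core {V : Type*} (G : SimpleGraph V) : SimpleGraph ↥(G.universalVertsᶜ) :=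
  G.induce G.universalVertsᶜ

end BellColoring

/-! Let `H` be the complement of `G`. With as many parts as vertices, stable partitions are the
partitions of `V` into cliques of `H`, and an edge labelled `v` joins two of them that agree off
`v`. Two clique partitions joined by at least two edges differ in exactly one pair of vertices, an
edge of `H` (`Double.exists_isFlip`). The discrete partition can be flipped in this way at every
edge of `H`.

An isomorphism sends the discrete partition to some `P` which, by counting, can also be flipped at
every edge. Then every nontrivial class of `P` is a component of the graph with two vertices, and
symmetric difference with `P` is an automorphism taking `P` to the discrete partition
(`exists_equiv_map_discrete`). So the discrete partition may be assumed fixed, and the partitions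
`pair e` yield a bijection of edges.

Three pairwise meeting distinct edges form a star or a triangle. Only for a triangle is there a
partition near all three pairs but not near the discrete one (`concurrent_iff`), so the bijection
preserves concurrency. It is then induced by an isomorphism away from isolated vertices
(`exists_support_equiv`), and isolated vertices of `H` are universal in `G`. -/

namespace BellColoring

/-! ### Edge bijections that preserve concurrency -/

section EdgeBijection

variable {V W : Type*}

/-- Three edges of `H` have a common end. -/
def Concurrent {H : SimpleGraph V} (e f g : H.edgeSet) : Prop :=
  ∃ u, u ∈ e.1 ∧ u ∈ f.1 ∧ u ∈ g.1

/-- The set of edges at a vertex. -/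
def star (H : SimpleGraph V) (u : V) : Set H.edgeSet := {e | u ∈ e.1}

theorem eq_of_mem_of_mem {H : SimpleGraph V} {e f : H.edgeSet} {u v : V} (huv : u ≠ v)
    (hu : u ∈ e.1) (hv : v ∈ e.1) (hu' : u ∈ f.1) (hv' : v ∈ f.1) : e = f :=
  Subtype.ext (((Sym2.mem_and_mem_iff huv).1 ⟨hu, hv⟩).trans
    ((Sym2.mem_and_mem_iff huv).1 ⟨hu', hv'⟩).symm)

theorem exists_ends {H : SimpleGraph V} (e : H.edgeSet) :
    ∃ a b, a ≠ b ∧ ∀ x, x ∈ e.1 ↔ x = a ∨ x = b := by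
  obtain ⟨e, he⟩ := e
  induction e with
  | _ a b => exact ⟨a, b, (H.mem_edgeSet.1 he).ne, fun x => Sym2.mem_iff⟩

/-- This makes any vertex bijection that matches stars preserve adjacency. -/
theorem adj_iff_star_inter {H : SimpleGraph V} {a b : V} :
    H.Adj a b ↔ a ≠ b ∧ (star H a ∩ star H b).Nonempty := by
  constructor
  · exact fun h => ⟨h.ne, ⟨s(a, b), h⟩, Sym2.mem_mk_left a b, Sym2.mem_mk_right a b⟩
  · rintro ⟨hab, e, ha, hb⟩
    have he := e.2
    rw [(Sym2.mem_and_mem_iff hab).1 ⟨ha, hb⟩] at he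
    exact he

variable {H : SimpleGraph V} {K : SimpleGraph W} (ψ : H.edgeSet ≃ K.edgeSet)

/-- Two distinct edges have at most one common end, so a star with two edges `e`, `f` consists of
the edges concurrent with them, a condition that `ψ` preserves. A star with a single edge needs a
separate argument. -/
theorem exists_star_eq_image
    (hψ : ∀ e f g, Concurrent (ψ e) (ψ f) (ψ g) ↔ Concurrent e f g) {u : V}
    (hu : (star H u).Nonempty) : ∃ w, star K w = ψ '' star H u := by
  obtain ⟨e, he⟩ := hu
  by_cases h : ∃ f ∈ star H u, f ≠ e
  · obtain ⟨f, hf, hfe⟩ := h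
    obtain ⟨w, hwe, hwf, -⟩ := (hψ e f f).2 ⟨u, he, hf, hf⟩
    refine ⟨w, Set.ext fun g' => ?_⟩
    obtain ⟨g, rfl⟩ := ψ.surjective g'
    rw [ψ.injective.mem_set_image]
    have key := hψ e f g
    constructor
    · intro hg
      obtain ⟨x, hxe, hxf, hxg⟩ := key.1 ⟨w, hwe, hwf, hg⟩
      by_cases hx : u = x
      · exact hx ▸ hxg
      · exact absurd (eq_of_mem_of_mem hx hf hxf he hxe) hfe
    · intro hg
      obtain ⟨x, hxe, hxf, hxg⟩ := key.2 ⟨u, he, hf, hg⟩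
      by_cases hx : w = x
      · exact hx ▸ hxg
      · exact absurd (ψ.injective (eq_of_mem_of_mem hx hwf hxf hwe hxe)) hfe
  · push Not at h
    have hs : star H u = {e} := Set.eq_singleton_iff_unique_mem.2 ⟨he, h⟩
    rw [hs, Set.image_singleton]
    obtain ⟨x, y, hxy, hends⟩ := exists_ends (ψ e)
    -- If neither end of `ψ e` has star `{ψ e}`, each carries a further edge, `ψ g` or `ψ k`. Since
    -- `u` lies only on `e`, both `g` and `k` meet `e` at its other end, so `e`, `g`, `k` are
    -- concurrent while their images are not.
    by_contra! hno
    have other : ∀ z ∈ (ψ e).1, ∃ g, z ∈ (ψ g).1 ∧ g ≠ e := by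
      intro z hz
      by_contra! hz'
      refine hno z (Set.eq_singleton_iff_unique_mem.2 ⟨hz, fun g' hg' => ?_⟩)
      obtain ⟨g, rfl⟩ := ψ.surjective g'
      rw [hz' g hg']
    have hx : x ∈ (ψ e).1 := (hends x).2 (Or.inl rfl)
    have hy : y ∈ (ψ e).1 := (hends y).2 (Or.inr rfl)
    obtain ⟨g, hg, hge⟩ := other x hx
    obtain ⟨k, hk, hke⟩ := other y hy
    obtain ⟨a, hae, hag, -⟩ := (hψ e g g).1 ⟨x, hx, hg, hg⟩
    obtain ⟨b, hbe, hbk, -⟩ := (hψ e k k).1 ⟨y, hy, hk, hk⟩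
    have hau : a ≠ u := fun hh => hge (h g (hh ▸ hag))
    have hbu : b ≠ u := fun hh => hke (h k (hh ▸ hbk))
    have hab : a = b := by
      have h1 := (Sym2.mem_and_mem_iff hau).1 ⟨hae, he⟩
      rw [h1, Sym2.mem_iff] at hbe
      exact (hbe.resolve_right hbu).symm
    subst hab
    obtain ⟨z, hze, hzg, hzk⟩ := (hψ e g k).2 ⟨a, hae, hag, hbk⟩
    rcases (hends z).1 hze with rfl | rfl
    · exact hke (ψ.injective (eq_of_mem_of_mem hxy hzk hk hx hy))
    · exact hge (ψ.injective (eq_of_mem_of_mem hxy hg hzg hx hy))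

/-- A nonempty star is shared by at most two vertices, and by two only when they are the ends of an
isolated edge. The image of that edge is then isolated too. -/
theorem ncard_star_fiber_le [Finite V] [Finite W]
    (hψ : ∀ e f g, Concurrent (ψ e) (ψ f) (ψ g) ↔ Concurrent e f g) {s : Set H.edgeSet}
    (hs : s.Nonempty) : {u | star H u = s}.ncard ≤ {w | star K w = ψ '' s}.ncard := by
  by_cases h1 : ∃ u v, u ≠ v ∧ star H u = s ∧ star H v = s
  · obtain ⟨u, v, huv, hu, hv⟩ := h1
    obtain ⟨e, he⟩ := hs
    have heu : u ∈ e.1 := by rw [← hu] at he; exact he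
    have hev : v ∈ e.1 := by rw [← hv] at he; exact he
    have hsub : {x | star H x = s} ⊆ {u, v} := by
      intro x hx
      have hex : x ∈ e.1 := by
        have := he
        rw [← (hx : star H x = s)] at this
        exact this
      rw [(Sym2.mem_and_mem_iff huv).1 ⟨heu, hev⟩] at hex
      simpa using hex
    have hse : s = {e} := by
      refine Set.eq_singleton_iff_unique_mem.2 ⟨he, fun f hf => ?_⟩
      have hfu : u ∈ f.1 := by rw [← hu] at hf; exact hf
      have hfv : v ∈ f.1 := by rw [← hv] at hf; exact hf
      exact eq_of_mem_of_mem huv hfu hfv heu hev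
    have hstar : ∀ z ∈ (ψ e).1, star K z = ψ '' s := by
      intro z hz
      rw [hse, Set.image_singleton]
      refine Set.eq_singleton_iff_unique_mem.2 ⟨hz, fun g' hg' => ?_⟩
      obtain ⟨g, rfl⟩ := ψ.surjective g'
      obtain ⟨a, hae, hag, -⟩ := (hψ e g g).1 ⟨z, hz, hg', hg'⟩
      have hgs : g ∈ s := by
        rw [(Sym2.mem_and_mem_iff huv).1 ⟨heu, hev⟩, Sym2.mem_iff] at hae
        rcases hae with rfl | rfl
        · rw [← hu]; exact hag
        · rw [← hv]; exact hag
      rw [hse] at hgs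
      rw [hgs]
    obtain ⟨x, y, hxy, hends⟩ := exists_ends (ψ e)
    have hsup : ({x, y} : Set W) ⊆ {w | star K w = ψ '' s} := by
      rintro z (rfl | rfl)
      · exact hstar _ ((hends _).2 (Or.inl rfl))
      · exact hstar _ ((hends _).2 (Or.inr rfl))
    calc _ ≤ ({u, v} : Set V).ncard := Set.ncard_le_ncard hsub (Set.toFinite _)
      _ = ({x, y} : Set W).ncard := by rw [Set.ncard_pair huv, Set.ncard_pair hxy]
      _ ≤ _ := Set.ncard_le_ncard hsup (Set.toFinite _)
  · push Not at h1
    rcases Set.eq_empty_or_nonempty {u | star H u = s} with h0 | ⟨u, hu⟩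
    · simp [h0]
    · have hle : {u | star H u = s}.ncard ≤ 1 :=
        (Set.ncard_le_one (Set.toFinite _)).2 fun a ha b hb => by
          by_contra hab
          exact h1 a b hab ha hb
      obtain ⟨w, hw⟩ := exists_star_eq_image ψ hψ (u := u) (by rw [hu]; exact hs)
      have hpos : 0 < {w | star K w = ψ '' s}.ncard :=
        (Set.ncard_pos (Set.toFinite _)).2 ⟨w, by rw [hu] at hw; exact hw⟩
      omega

/-- A bijection between the edges of two finite graphs that preserves concurrency of triples is
induced by an isomorphism between the graphs without their isolated vertices. -/
theorem exists_support_equiv [Finite V] [Finite W]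
    (hψ : ∀ e f g, Concurrent (ψ e) (ψ f) (ψ g) ↔ Concurrent e f g) :
    ∃ F : {u // (star H u).Nonempty} ≃ {w // (star K w).Nonempty},
      ∀ u v, K.Adj (F u) (F v) ↔ H.Adj u v := by
  have hψ' : ∀ e f g, Concurrent (ψ.symm e) (ψ.symm f) (ψ.symm g) ↔ Concurrent e f g := by
    intro e f g
    rw [← hψ]
    simp
  have hcard : ∀ s : Set H.edgeSet, s.Nonempty →
      {u | star H u = s}.ncard = {w | star K w = ψ '' s}.ncard := by
    intro s hs
    refine le_antisymm (ncard_star_fiber_le ψ hψ hs) ?_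
    have := ncard_star_fiber_le ψ.symm hψ' (hs.image ψ)
    rwa [Equiv.symm_image_image] at this
  -- Vertices with the same star are interchangeable, so it is enough to match the fibres of the two
  -- star maps by arbitrary bijections.
  let π : {u // (star H u).Nonempty} → Set K.edgeSet := fun u => ψ '' star H u
  let π' : {w // (star K w).Nonempty} → Set K.edgeSet := fun w => star K w
  have hfib : ∀ t : Set K.edgeSet, Nonempty ({u // π u = t} ≃ {w // π' w = t}) := by
    intro t
    rcases t.eq_empty_or_nonempty with rfl | ht
    · have h1 : IsEmpty {u // π u = ∅} :=
        ⟨fun u => (u.1.2.image ψ).ne_empty u.2⟩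
      have h2 : IsEmpty {w // π' w = ∅} := ⟨fun w => w.1.2.ne_empty w.2⟩
      exact ⟨Equiv.equivOfIsEmpty _ _⟩
    · obtain ⟨s, rfl⟩ : ∃ s, t = ψ '' s := ⟨ψ.symm '' t, by simp⟩
      have hs : s.Nonempty := Set.image_nonempty.1 ht
      have e1 : {u // π u = ψ '' s} ≃ {u | star H u = s} :=
        { toFun := fun u => ⟨u.1.1, ψ.injective.image_injective u.2⟩
          invFun := fun u => ⟨⟨u.1, by rw [u.2]; exact hs⟩, congrArg (ψ '' ·) u.2⟩
          left_inv := fun _ => rfl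
          right_inv := fun _ => rfl }
      have e2 : {w // π' w = ψ '' s} ≃ {w | star K w = ψ '' s} :=
        { toFun := fun w => ⟨w.1.1, w.2⟩
          invFun := fun w => ⟨⟨w.1, by rw [w.2]; exact ht⟩, w.2⟩
          left_inv := fun _ => rfl
          right_inv := fun _ => rfl }
      obtain ⟨e3⟩ := Finite.card_eq.1 (hcard s hs)
      exact ⟨e1.trans (e3.trans e2.symm)⟩
  let E := fun t => (hfib t).some
  let F := (Equiv.sigmaFiberEquiv π).symm.trans
    ((Equiv.sigmaCongrRight E).trans (Equiv.sigmaFiberEquiv π'))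
  have hF : ∀ u, star K (F u) = ψ '' star H u := fun u => (E (π u) ⟨u, rfl⟩).2
  refine ⟨F, fun u v => ?_⟩
  rw [adj_iff_star_inter, adj_iff_star_inter, hF, hF, ← Set.image_inter ψ.injective, Set.image_nonempty]
  simp [← Subtype.ext_iff]

end EdgeBijection

/-! ### Clique partitions, single and double adjacency -/

/-- The equivalence relations on the vertices of `H` all of whose classes are cliques of `H`. -/
abbrev CliqueSetoid {V : Type*} (H : SimpleGraph V) : Type _ :=
  {r : Setoid V // ∀ a b, r a b → a ≠ b → H.Adj a b}

namespace CliqueSetoid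

variable {V : Type*} {H : SimpleGraph V}

theorem comm (P : CliqueSetoid H) {a b : V} : P.1 a b ↔ P.1 b a := ⟨P.1.symm, P.1.symm⟩

theorem ext_of_ne {P Q : CliqueSetoid H} (h : ∀ a b, a ≠ b → (P.1 a b ↔ Q.1 a b)) : P = Q := by
  refine Subtype.ext (Setoid.ext fun a b => ?_)
  by_cases hab : a = b
  · subst hab
    exact iff_of_true (P.1.refl a) (Q.1.refl a)
  · exact h a b hab

/-- Two equivalence relations coincide on the vertices other than `v`. -/
def AgreeOff (v : V) (P Q : CliqueSetoid H) : Prop :=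
  ∀ a b, a ≠ v → b ≠ v → (P.1 a b ↔ Q.1 a b)

theorem AgreeOff.symm {v : V} {P Q : CliqueSetoid H} (h : AgreeOff v P Q) : AgreeOff v Q P :=
  fun a b ha hb => (h a b ha hb).symm

theorem AgreeOff.trans {v : V} {P Q R : CliqueSetoid H} (h : AgreeOff v P Q)
    (h' : AgreeOff v Q R) : AgreeOff v P R :=
  fun a b ha hb => (h a b ha hb).trans (h' a b ha hb)

/-- `P` and `Q` are equal or joined by an edge. -/
def Near (P Q : CliqueSetoid H) : Prop := P = Q ∨ ∃ v, AgreeOff v P Q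

/-- `P` and `Q` are joined by at least two edges. -/
def Double (P Q : CliqueSetoid H) : Prop :=
  P ≠ Q ∧ ∃ v w, v ≠ w ∧ AgreeOff v P Q ∧ AgreeOff w P Q

/-- The partition into singletons. -/
def discrete (H : SimpleGraph V) : CliqueSetoid H := ⟨⊥, fun _ _ h h' => absurd h h'⟩

theorem discrete_apply {a b : V} : (discrete H).1 a b ↔ a = b := Iff.rfl

/-- The partition whose only class that is not a singleton consists of the ends of `e`. -/
def pair (e : H.edgeSet) : CliqueSetoid H :=
  ⟨{ r := fun a b => a = b ∨ s(a, b) = e.1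
     iseqv :=
      { refl := fun a => Or.inl rfl
        symm := by
          rintro a b (h | h)
          · exact Or.inl h.symm
          · exact Or.inr (Sym2.eq_swap.trans h)
        trans := by
          rintro a b c (rfl | h) (rfl | h')
          · exact Or.inl rfl
          · exact Or.inr h'
          · exact Or.inr h
          · left
            rw [← h, Sym2.eq_swap] at h'
            exact (Sym2.congr_left.1 h').symm } },
    by
      rintro a b (h | h) hab
      · exact absurd h hab
      · have := e.2
        rw [← h] at this
        exact this⟩

theorem pair_apply {e : H.edgeSet} {a b : V} : (pair e).1 a b ↔ a = b ∨ s(a, b) = e.1 := Iff.rfl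

theorem pair_injective : Function.Injective (pair : H.edgeSet → CliqueSetoid H) := by
  intro e f hef
  obtain ⟨⟨a, b⟩, he⟩ := e
  have h : (pair f).1 a b := by
    rw [← hef]
    exact Or.inr rfl
  exact Subtype.ext (h.resolve_left (H.mem_edgeSet.1 he).ne)

theorem agreeOff_discrete {e : H.edgeSet} {v : V} (hv : v ∈ e.1) :
    AgreeOff v (pair e) (discrete H) := by
  intro a b ha hb
  rw [pair_apply, discrete_apply]
  refine or_iff_left fun h => ?_
  rw [← h, Sym2.mem_iff] at hv
  rcases hv with rfl | rfl
  · exact ha rfl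
  · exact hb rfl

theorem double_pair_discrete (e : H.edgeSet) : Double (discrete H) (pair e) := by
  obtain ⟨a, b, hab, hends⟩ := exists_ends e
  have ha := (hends a).2 (Or.inl rfl)
  have hb := (hends b).2 (Or.inr rfl)
  refine ⟨fun h => ?_, a, b, hab, (agreeOff_discrete ha).symm, (agreeOff_discrete hb).symm⟩
  have : (pair e).1 a b := Or.inr ((Sym2.mem_and_mem_iff hab).1 ⟨ha, hb⟩).symm
  rw [← h] at this
  exact hab this

/-- `Q` arises from `P` by changing the relation exactly at the ends of `e`. -/
def IsFlip (P : CliqueSetoid H) (e : H.edgeSet) (Q : CliqueSetoid H) : Prop :=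
  ∀ a b, a ≠ b → (Q.1 a b ↔ ¬(P.1 a b ↔ s(a, b) = e.1))

theorem IsFlip.unique {P Q R : CliqueSetoid H} {e : H.edgeSet} (hQ : IsFlip P e Q)
    (hR : IsFlip P e R) : Q = R :=
  ext_of_ne fun a b hab => (hQ a b hab).trans (hR a b hab).symm

/-- Any pair other than `{v, w}` avoids `v` or `w`, so it is unchanged. Hence `{v, w}` itself
changes, and it is an edge because one of `P`, `Q` puts its ends together. -/
theorem Double.exists_isFlip {P Q : CliqueSetoid H} (h : Double P Q) : ∃ e, IsFlip P e Q := by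
  obtain ⟨hne, v, w, hvw, hv, hw⟩ := h
  have hsame : ∀ a b, a ≠ b → s(a, b) ≠ s(v, w) → (P.1 a b ↔ Q.1 a b) := by
    intro a b hab hs
    by_cases h1 : a ≠ v ∧ b ≠ v
    · exact hv a b h1.1 h1.2
    · refine hw a b ?_ ?_ <;> rintro rfl <;> apply hs <;> grind
  have hdiff : ¬(P.1 v w ↔ Q.1 v w) := by
    intro hiff
    refine hne (ext_of_ne fun a b hab => ?_)
    by_cases hs : s(a, b) = s(v, w)
    · rcases Sym2.eq_iff.1 hs with ⟨rfl, rfl⟩ | ⟨rfl, rfl⟩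
      · exact hiff
      · rw [comm P, comm Q]
        exact hiff
    · exact hsame a b hab hs
  have hadj : H.Adj v w := by
    by_cases hP : P.1 v w
    · exact P.2 v w hP hvw
    · by_cases hQ : Q.1 v w
      · exact Q.2 v w hQ hvw
      · exact absurd (iff_of_false hP hQ) hdiff
  refine ⟨⟨s(v, w), hadj⟩, fun a b hab => ?_⟩
  by_cases hs : s(a, b) = s(v, w)
  · have : ¬(P.1 a b ↔ Q.1 a b) := by
      rcases Sym2.eq_iff.1 hs with ⟨rfl, rfl⟩ | ⟨rfl, rfl⟩
      · exact hdiff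
      · rw [comm P, comm Q]
        exact hdiff
    simp only [hs]
    tauto
  · have := hsame a b hab hs
    simp only [hs]
    tauto

theorem IsFlip.eq_pair {e : H.edgeSet} {Q : CliqueSetoid H} (h : IsFlip (discrete H) e Q) :
    Q = pair e := by
  refine ext_of_ne fun a b hab => (h a b hab).trans ?_
  rw [pair_apply, discrete_apply]
  tauto

/-- If `P` can be changed at each edge of `H`, then every nontrivial pair of `P` spans a component
of `H`. -/
theorem eq_of_adj_of_forall_isFlip {P : CliqueSetoid H} (h : ∀ e, ∃ Q, IsFlip P e Q) {a b c : V}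
    (hab : P.1 a b) (hne : a ≠ b) (hac : H.Adj a c) : c = b := by
  by_contra hcb
  obtain ⟨Q, hQ⟩ := h ⟨s(a, c), hac⟩
  have h1 := hQ a b hne
  have h2 := hQ a c hac.ne
  have h3 := hQ b c (Ne.symm hcb)
  have e1 : s(a, b) ≠ s(a, c) := fun hh => hcb (Sym2.congr_right.1 hh).symm
  have e3 : s(b, c) ≠ s(a, c) := fun hh => hne (Sym2.congr_left.1 hh).symm
  simp only [e1, e3, hab, iff_false, not_not, iff_true] at h1 h2 h3
  -- Since `a` and `b` are together in both `P` and `Q`, the pairs `ac` and `bc` have equal status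
  -- in each; but the flip changes `ac` and not `bc`.
  have t1 : P.1 a c ↔ P.1 b c := ⟨P.1.trans (P.1.symm hab), P.1.trans hab⟩
  have t2 : Q.1 a c ↔ Q.1 b c := ⟨Q.1.trans (Q.1.symm h1), Q.1.trans h1⟩
  tauto

/-- The symmetric difference with `P`, off the diagonal. -/
def toggle (P : CliqueSetoid H) (hP : ∀ a b c, P.1 a b → a ≠ b → H.Adj a c → c = b)
    (Q : CliqueSetoid H) : CliqueSetoid H :=
  have hadj : ∀ a b, a ≠ b → ¬(Q.1 a b ↔ P.1 a b) → H.Adj a b := by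
    intro a b hab h
    by_cases hp : P.1 a b
    · exact P.2 a b hp hab
    · exact Q.2 a b (by tauto) hab
  ⟨{ r := fun a b => a = b ∨ ¬(Q.1 a b ↔ P.1 a b)
     iseqv :=
      { refl := fun a => Or.inl rfl
        symm := by
          intro a b h
          rw [comm Q, comm P, eq_comm]
          exact h
        trans := by
          intro a b c h h'
          by_cases hac : a = c
          · exact Or.inl hac
          by_cases hab : a = b
          · exact hab ▸ h'
          by_cases hbc : b = c
          · exact hbc ▸ h
          have h := h.resolve_left hab
          have h' := h'.resolve_left hbc
          -- A nontrivial pair of `P` is a whole component of `H`, so none of the pairs in the path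
          -- `a`, `b`, `c` is in `P`. Transitivity is then that of `Q`.
          have Hab := hadj a b hab h
          have Hbc := hadj b c hbc h'
          have p1 : ¬P.1 a b := fun p => hac (hP b a c (P.1.symm p) (Ne.symm hab) Hbc).symm
          have p2 : ¬P.1 b c := fun p => hac (hP b c a p hbc Hab.symm)
          have p3 : ¬P.1 a c := fun p => hbc (hP a c b p hac Hab)
          have q1 : Q.1 a b := by tauto
          have q2 : Q.1 b c := by tauto
          have q3 := Q.1.trans q1 q2
          exact Or.inr (by tauto) } },
    fun a b h hab => hadj a b hab (h.resolve_left hab)⟩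

/-! ### Symmetric difference as an automorphism -/

section Toggle

variable {P : CliqueSetoid H} (hP : ∀ a b c, P.1 a b → a ≠ b → H.Adj a c → c = b)

theorem toggle_apply {Q : CliqueSetoid H} {a b : V} :
    (toggle P hP Q).1 a b ↔ a = b ∨ ¬(Q.1 a b ↔ P.1 a b) := Iff.rfl

theorem toggle_self : toggle P hP P = discrete H :=
  ext_of_ne fun a b hab => by
    rw [toggle_apply, discrete_apply]
    tauto

theorem toggle_involutive : Function.Involutive (toggle P hP) := fun Q =>
  ext_of_ne fun a b hab => by
    rw [toggle_apply, toggle_apply]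
    tauto

theorem agreeOff_toggle {v : V} {Q R : CliqueSetoid H} (h : AgreeOff v Q R) :
    AgreeOff v (toggle P hP Q) (toggle P hP R) := by
  intro a b ha hb
  rw [toggle_apply, toggle_apply, h a b ha hb]

theorem agreeOff_toggle_iff {v : V} {Q R : CliqueSetoid H} :
    AgreeOff v (toggle P hP Q) (toggle P hP R) ↔ AgreeOff v Q R := by
  refine ⟨fun h => ?_, agreeOff_toggle hP⟩
  have := agreeOff_toggle hP h
  rwa [toggle_involutive hP, toggle_involutive hP] at this

theorem near_toggle_iff {Q R : CliqueSetoid H} :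
    Near (toggle P hP Q) (toggle P hP R) ↔ Near Q R := by
  simp only [Near, agreeOff_toggle_iff, (toggle_involutive hP).injective.eq_iff]

theorem double_toggle_iff {Q R : CliqueSetoid H} :
    Double (toggle P hP Q) (toggle P hP R) ↔ Double Q R := by
  simp only [Double, agreeOff_toggle_iff, ne_eq, (toggle_involutive hP).injective.eq_iff]

end Toggle

/-! ### Telling stars from triangles -/

theorem near_pair_pair_iff {e f : H.edgeSet} :
    Near (pair e) (pair f) ↔ ∃ v, v ∈ e.1 ∧ v ∈ f.1 := by
  have aux : ∀ {e f : H.edgeSet} {v : V}, e ≠ f → AgreeOff v (pair e) (pair f) → v ∈ e.1 := by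
    intro e f v hef h
    obtain ⟨a, b, hab, hends⟩ := exists_ends e
    by_contra hv
    rw [hends] at hv
    push Not at hv
    have he := (Sym2.mem_and_mem_iff hab).1 ⟨(hends a).2 (Or.inl rfl), (hends b).2 (Or.inr rfl)⟩
    have := ((h a b hv.1.symm hv.2.symm).1 (Or.inr he.symm)).resolve_left hab
    exact hef (Subtype.ext (he.trans this))
  constructor
  · intro h
    by_cases hef : e = f
    · obtain ⟨a, b, -, hends⟩ := exists_ends e
      exact ⟨a, (hends a).2 (Or.inl rfl), hef ▸ (hends a).2 (Or.inl rfl)⟩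
    · obtain ⟨v, hv⟩ := h.resolve_left fun h => hef (pair_injective h)
      exact ⟨v, aux hef hv, aux (Ne.symm hef) hv.symm⟩
  · rintro ⟨v, he, hf⟩
    exact Or.inr ⟨v, (agreeOff_discrete he).trans (agreeOff_discrete hf).symm⟩

/-- Some partition that is not near the discrete one is near the three given pairs. -/
def HasCommonNear (e f g : H.edgeSet) : Prop :=
  ∃ Q : CliqueSetoid H, ¬Near Q (discrete H) ∧ Near Q (pair e) ∧ Near Q (pair f) ∧ Near Q (pair g)

/-- A partition near `pair e` and not near the discrete one puts the ends of `e` together, and it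
arises by moving a vertex that is not an end of `e`. -/
theorem exists_agreeOff_of_near_pair {Q : CliqueSetoid H} (hQ : ¬Near Q (discrete H))
    {e : H.edgeSet} (he : Near Q (pair e)) :
    ∃ v, v ∉ e.1 ∧ AgreeOff v Q (pair e) := by
  rcases he with rfl | ⟨v, hv⟩
  · obtain ⟨a, b, -, hends⟩ := exists_ends e
    exact absurd (Or.inr ⟨a, agreeOff_discrete ((hends a).2 (Or.inl rfl))⟩) hQ
  · exact ⟨v, fun hve => hQ (Or.inr ⟨v, hv.trans (agreeOff_discrete hve)⟩), hv⟩

/-- Such a `Q` would put `u` together with the other ends `a`, `b`, `c` of the three edges. But off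
one vertex `v` it agrees with `pair e`, and `v` can account for only one of `b` and `c`. -/
theorem not_hasCommonNear_of_concurrent {e f g : H.edgeSet} (hef : e ≠ f) (hfg : f ≠ g)
    (heg : e ≠ g) (h : Concurrent e f g) : ¬HasCommonNear e f g := by
  obtain ⟨u, hue, huf, hug⟩ := h
  rintro ⟨Q, hQ, he, hf, hg⟩
  have other : ∀ e : H.edgeSet, u ∈ e.1 → ∃ a, a ≠ u ∧ s(u, a) = e.1 := by
    intro e hu
    obtain ⟨a, ha⟩ := hu
    refine ⟨a, ?_, ha.symm⟩
    have := e.2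
    rw [ha] at this
    exact (H.mem_edgeSet.1 this).ne'
  have together : ∀ e : H.edgeSet, ∀ a, s(u, a) = e.1 → Near Q (pair e) → Q.1 u a := by
    intro e a ha hn
    obtain ⟨v, hv, hag⟩ := exists_agreeOff_of_near_pair hQ hn
    rw [← ha, Sym2.mem_iff] at hv
    push Not at hv
    exact (hag u a hv.1.symm hv.2.symm).2 (Or.inr ha)
  obtain ⟨a, hau, ha⟩ := other e hue
  obtain ⟨b, hbu, hb⟩ := other f huf
  obtain ⟨c, hcu, hc⟩ := other g hug
  have hub := together f b hb hf
  have huc := together g c hc hg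
  obtain ⟨v, hv, hag⟩ := exists_agreeOff_of_near_pair hQ he
  have hvu : u ≠ v := fun h => hv (h ▸ hue)
  have hbc : b ≠ c := fun h => hfg (Subtype.ext (by rw [← hb, ← hc, h]))
  by_cases hbv : b = v
  · have hcv : c ≠ v := fun h => hbc (hbv.trans h.symm)
    rcases (hag u c hvu hcv).1 huc with h | h
    · exact hcu h.symm
    · exact heg (Subtype.ext (h.symm.trans hc))
  · rcases (hag u b hvu hbv).1 hub with h | h
    · exact hbu h.symm
    · exact hef (Subtype.ext (h.symm.trans hb))

/-- The partition whose only nontrivial class is the triangle `a`, `b`, `c`. -/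
def triple {a b c : V} (hab : H.Adj a b) (hbc : H.Adj b c) (hac : H.Adj a c) : CliqueSetoid H :=
  ⟨{ r := fun x y => x = y ∨ ((x = a ∨ x = b ∨ x = c) ∧ (y = a ∨ y = b ∨ y = c))
     iseqv :=
      { refl := fun x => Or.inl rfl
        symm := by
          rintro x y (h | h)
          · exact Or.inl h.symm
          · exact Or.inr h.symm
        trans := by
          rintro x y z (rfl | h) (rfl | h')
          · exact Or.inl rfl
          · exact Or.inr h'
          · exact Or.inr h
          · exact Or.inr ⟨h.1, h'.2⟩ } },
    by
      have := hab.symm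
      have := hbc.symm
      have := hac.symm
      rintro x y (h | ⟨rfl | rfl | rfl, rfl | rfl | rfl⟩) hxy <;>
        first | assumption | exact absurd rfl hxy | exact absurd h hxy⟩

/-- The witness is the triangle as one class: isolating a vertex leaves the opposite edge, but no
single move separates all three. -/
theorem hasCommonNear_of_triangle {a b c : V} (hab : H.Adj a b) (hbc : H.Adj b c)
    (hac : H.Adj a c) :
    HasCommonNear (⟨s(a, b), hab⟩ : H.edgeSet) ⟨s(b, c), hbc⟩ ⟨s(a, c), hac⟩ := by
  have key : ∀ x y, (triple hab hbc hac).1 x y ↔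
    x = y ∨ ((x = a ∨ x = b ∨ x = c) ∧ (y = a ∨ y = b ∨ y = c)) := fun _ _ => Iff.rfl
  have h1 := hab.ne
  have h2 := hbc.ne
  have h3 := hac.ne
  refine ⟨triple hab hbc hac, ?_, Or.inr ⟨c, ?_⟩, Or.inr ⟨a, ?_⟩, Or.inr ⟨b, ?_⟩⟩
  · rintro (h | ⟨v, h⟩)
    · have : (triple hab hbc hac).1 a b := by simp [key]
      rw [h] at this
      exact h1 this
    · have k1 := h a b
      have k2 := h b c
      have k3 := h a c
      simp only [key, discrete_apply] at k1 k2 k3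
      by_cases hva : a = v
      · subst hva
        simp [h1.symm, h3.symm, h2] at k2
      · by_cases hvb : b = v
        · subst hvb
          simp [h2.symm, h3, h1] at k3
        · simp [hva, hvb, h1] at k1
  all_goals
    intro x y hx hy
    rw [key, pair_apply, Sym2.eq_iff]
    grind

/-- The right side mentions only `Near`, the pairs and the discrete partition, so it transfers along
bijections that respect these. For repeated edges, meeting pairwise already suffices. -/
theorem concurrent_iff {e f g : H.edgeSet} :
    Concurrent e f g ↔ (Near (pair e) (pair f) ∧ Near (pair f) (pair g) ∧
      Near (pair e) (pair g)) ∧ (e = f ∨ f = g ∨ e = g ∨ ¬HasCommonNear e f g) := by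
  simp only [near_pair_pair_iff]
  constructor
  · intro h
    refine ⟨?_, ?_⟩
    · obtain ⟨u, h1, h2, h3⟩ := h
      exact ⟨⟨u, h1, h2⟩, ⟨u, h2, h3⟩, ⟨u, h1, h3⟩⟩
    · by_contra! hne
      exact not_hasCommonNear_of_concurrent hne.1 hne.2.1 hne.2.2.1 h hne.2.2.2
  · rintro ⟨⟨⟨x, hxe, hxf⟩, ⟨y, hyf, hyg⟩, ⟨z, hze, hzg⟩⟩, h⟩
    rcases h with rfl | rfl | rfl | h
    · exact ⟨y, hyf, hyf, hyg⟩
    · exact ⟨x, hxe, hxf, hxf⟩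
    · exact ⟨x, hxe, hxf, hxe⟩
    · by_cases hxy : x = y
      · subst hxy
        exact ⟨x, hxe, hxf, hyg⟩
      by_cases hyz : y = z
      · subst hyz
        exact ⟨y, hze, hyf, hyg⟩
      by_cases hxz : x = z
      · subst hxz
        exact ⟨x, hxe, hxf, hzg⟩
      obtain ⟨e, he⟩ := e
      obtain ⟨f, hf⟩ := f
      obtain ⟨g, hg⟩ := g
      obtain rfl := (Sym2.mem_and_mem_iff (Ne.symm hxz)).1 ⟨hze, hxe⟩
      obtain rfl := (Sym2.mem_and_mem_iff hxy).1 ⟨hxf, hyf⟩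
      obtain rfl := (Sym2.mem_and_mem_iff (Ne.symm hyz)).1 ⟨hzg, hyg⟩
      exact absurd (hasCommonNear_of_triangle he hf hg) h

/-! ### From a bijection of partitions to one of edges -/

section Transfer

variable {W : Type*} {K : SimpleGraph W}

theorem exists_injective_isFlip (φ : CliqueSetoid H ≃ CliqueSetoid K)
    (hD : ∀ P Q, Double (φ P) (φ Q) ↔ Double P Q) :
    ∃ g : H.edgeSet → K.edgeSet, Function.Injective g ∧
      ∀ e, IsFlip (φ (discrete H)) (g e) (φ (pair e)) := by
  choose g hg using fun e : H.edgeSet => ((hD _ _).2 (double_pair_discrete e)).exists_isFlip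
  refine ⟨g, fun e f hef => ?_, hg⟩
  have hf := hg f
  rw [← hef] at hf
  exact pair_injective (φ.injective ((hg e).unique hf))

theorem exists_bijective_isFlip [Finite V] [Finite W] (φ : CliqueSetoid H ≃ CliqueSetoid K)
    (hD : ∀ P Q, Double (φ P) (φ Q) ↔ Double P Q) :
    ∃ g : H.edgeSet → K.edgeSet, Function.Bijective g ∧
      ∀ e, IsFlip (φ (discrete H)) (g e) (φ (pair e)) := by
  obtain ⟨g, hg, hflip⟩ := exists_injective_isFlip φ hD
  obtain ⟨g', hg', -⟩ := exists_injective_isFlip φ.symm fun P Q => by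
    rw [← hD]
    simp
  -- The map `g'` is used only to compare cardinalities; it need not invert `g`.
  exact ⟨g, hg.bijective_of_nat_card_le (Nat.card_le_card_of_injective g' hg'), hflip⟩

/-- A bijection between clique partitions preserving simple and multiple adjacency can be chosen
to fix the discrete partition. -/
theorem exists_equiv_map_discrete [Finite V] [Finite W] (φ : CliqueSetoid H ≃ CliqueSetoid K)
    (hN : ∀ P Q, Near (φ P) (φ Q) ↔ Near P Q) (hD : ∀ P Q, Double (φ P) (φ Q) ↔ Double P Q) :
    ∃ φ' : CliqueSetoid H ≃ CliqueSetoid K, (∀ P Q, Near (φ' P) (φ' Q) ↔ Near P Q) ∧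
      (∀ P Q, Double (φ' P) (φ' Q) ↔ Double P Q) ∧ φ' (discrete H) = discrete K := by
  obtain ⟨g, hg, hflip⟩ := exists_bijective_isFlip φ hD
  have hP : ∀ a b c, (φ (discrete H)).1 a b → a ≠ b → K.Adj a c → c = b := fun a b c =>
    eq_of_adj_of_forall_isFlip fun e => by
      obtain ⟨e, rfl⟩ := hg.2 e
      exact ⟨_, hflip e⟩
  refine ⟨φ.trans (toggle_involutive hP).toPerm, fun P Q => ?_, fun P Q => ?_, toggle_self hP⟩
  · exact (near_toggle_iff hP).trans (hN P Q)
  · exact (double_toggle_iff hP).trans (hD P Q)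

theorem exists_edge_equiv [Finite V] [Finite W] (φ : CliqueSetoid H ≃ CliqueSetoid K)
    (hN : ∀ P Q, Near (φ P) (φ Q) ↔ Near P Q) (hD : ∀ P Q, Double (φ P) (φ Q) ↔ Double P Q) :
    ∃ ψ : H.edgeSet ≃ K.edgeSet,
      ∀ e f g, Concurrent (ψ e) (ψ f) (ψ g) ↔ Concurrent e f g := by
  obtain ⟨φ, hN, hD, h0⟩ := exists_equiv_map_discrete φ hN hD
  obtain ⟨g, hg, hflip⟩ := exists_bijective_isFlip φ hD
  have hpair : ∀ e, pair (g e) = φ (pair e) := fun e => by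
    have := hflip e
    rw [h0] at this
    exact this.eq_pair.symm
  refine ⟨Equiv.ofBijective g hg, fun e f k => ?_⟩
  simp only [Equiv.ofBijective_apply, concurrent_iff, HasCommonNear, hpair, hN, hg.1.eq_iff,
    φ.surjective.exists, ← h0]

end Transfer

end CliqueSetoid

/-! ### Multisets of disjoint sets -/

section Multisets

variable {V : Type*}

/-- Two vertices lie in a common part. -/
def Related (P : Multiset (Finset V)) (a b : V) : Prop := ∃ A ∈ P, a ∈ A ∧ b ∈ A

theorem eq_of_countP_le_one {α : Type*} {p : α → Prop} [DecidablePred p] {P : Multiset α}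
    (h : P.countP p ≤ 1) {A B : α} (hA : A ∈ P) (hB : B ∈ P) (hpA : p A) (hpB : p B) :
    A = B := by
  obtain ⟨Q, rfl⟩ := Multiset.exists_cons_of_mem hA
  rw [Multiset.countP_cons_of_pos _ hpA] at h
  rcases Multiset.mem_cons.1 hB with rfl | hB
  · rfl
  · have := Multiset.countP_pos.2 ⟨B, hB, hpB⟩
    omega

variable [DecidableEq V]

/-- A nonempty part is the class of any of its elements, and disjointness bounds its multiplicity by
one. -/
theorem count_le_count_of_related {P Q : Multiset (Finset V)}
    (hP : ∀ a, P.countP (fun A => a ∈ A) ≤ 1) (hQ : ∀ a, Q.countP (fun A => a ∈ A) ≤ 1)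
    (h : ∀ a b, Related P a b ↔ Related Q a b) {A : Finset V} (hA : A.Nonempty) :
    P.count A ≤ Q.count A := by
  obtain ⟨a, ha⟩ := hA
  by_cases hAP : A ∈ P
  · obtain ⟨B, hB, haB, -⟩ := (h a a).1 ⟨A, hAP, ha, ha⟩
    have hAB : A = B := by
      ext x
      constructor
      · intro hx
        obtain ⟨C, hC, haC, hxC⟩ := (h a x).1 ⟨A, hAP, ha, hx⟩
        rwa [eq_of_countP_le_one (hQ a) hB hC haB haC]
      · intro hx
        obtain ⟨C, hC, haC, hxC⟩ := (h a x).2 ⟨B, hB, haB, hx⟩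
        rwa [eq_of_countP_le_one (hP a) hAP hC ha haC]
    have h1 : P.count A ≤ P.countP (fun A => a ∈ A) := by
      rw [Multiset.count, Multiset.countP_eq_card_filter, Multiset.countP_eq_card_filter]
      refine Multiset.card_le_card (Multiset.monotone_filter_right _ fun B hB => ?_)
      exact hB ▸ ha
    have h2 : 0 < Q.count A := Multiset.count_pos.2 (hAB ▸ hB)
    have := hP a
    omega
  · rw [Multiset.count_eq_zero_of_notMem hAP]
    exact Nat.zero_le _

/-- A multiset of disjoint sets is determined by its size and by which elements it puts
together. -/
theorem eq_of_related_iff {P Q : Multiset (Finset V)} (hcard : P.card = Q.card)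
    (hP : ∀ a, P.countP (fun A => a ∈ A) ≤ 1) (hQ : ∀ a, Q.countP (fun A => a ∈ A) ≤ 1)
    (h : ∀ a b, Related P a b ↔ Related Q a b) : P = Q := by
  have hcount : ∀ A : Finset V, A ≠ ∅ → P.count A = Q.count A := fun A hA =>
    le_antisymm (count_le_count_of_related hP hQ h (Finset.nonempty_iff_ne_empty.2 hA))
      (count_le_count_of_related hQ hP (fun a b => (h a b).symm)
        (Finset.nonempty_iff_ne_empty.2 hA))
  have hfilter : P.filter (fun A => ¬∅ = A) = Q.filter (fun A => ¬∅ = A) := by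
    ext A
    rw [Multiset.count_filter, Multiset.count_filter]
    split_ifs with hA
    · rfl
    · exact hcount A (Ne.symm hA)
  ext A
  by_cases hA : A = ∅
  -- The relation does not see empty parts; their number is forced by the total size.
  · subst hA
    have h1 := Multiset.card_eq_countP_add_countP (fun A => ∅ = A) P
    have h2 := Multiset.card_eq_countP_add_countP (fun A => ∅ = A) Q
    rw [Multiset.countP_eq_card_filter (fun A => ¬∅ = A)] at h1 h2
    rw [hfilter] at h1
    rw [Multiset.count]
    omega
  · exact hcount A hA

theorem related_removeVertex {P : Multiset (Finset V)} {v a b : V} :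
    Related (removeVertex P v) a b ↔ a ≠ v ∧ b ≠ v ∧ Related P a b := by
  simp only [Related, removeVertex, Multiset.mem_map]
  constructor
  · rintro ⟨_, ⟨A, hA, rfl⟩, ha, hb⟩
    simp only [Finset.mem_erase] at ha hb
    exact ⟨ha.1, hb.1, A, hA, ha.2, hb.2⟩
  · rintro ⟨ha, hb, A, hA, haA, hbA⟩
    exact ⟨_, ⟨A, hA, rfl⟩, Finset.mem_erase.2 ⟨ha, haA⟩, Finset.mem_erase.2 ⟨hb, hbA⟩⟩

theorem countP_removeVertex_le (P : Multiset (Finset V)) (v a : V) :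
    (removeVertex P v).countP (fun A => a ∈ A) ≤ P.countP (fun A => a ∈ A) := by
  rw [removeVertex, Multiset.countP_map, Multiset.countP_eq_card_filter]
  exact Multiset.card_le_card
    (Multiset.monotone_filter_right _ fun B hB => Finset.mem_of_mem_erase hB)

end Multisets

/-! ### Stable partitions as clique partitions of the complement -/

section StablePartitions

variable {V : Type*} [DecidableEq V] {G : SimpleGraph V} {k : ℕ}

/-- The equivalence relation of a stable partition. -/
def IsStablePartition.toCliqueSetoid {P : Multiset (Finset V)} (h : IsStablePartition G k P) :
    CliqueSetoid Gᶜ :=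
  ⟨{ r := Related P
     iseqv :=
      { refl := fun a => by
          obtain ⟨A, hA, ha⟩ := Multiset.countP_pos.1 ((h.partition a).symm ▸ Nat.one_pos)
          exact ⟨A, hA, ha, ha⟩
        symm := fun ⟨A, hA, ha, hb⟩ => ⟨A, hA, hb, ha⟩
        trans := by
          rintro a b c ⟨A, hA, ha, hb⟩ ⟨B, hB, hb', hc⟩
          obtain rfl := eq_of_countP_le_one (h.partition b).le hA hB hb hb'
          exact ⟨A, hA, ha, hc⟩ } },
    fun a b ⟨A, hA, ha, hb⟩ hab => (SimpleGraph.compl_adj G a b).2 ⟨hab, h.indep A hA ha hb hab⟩⟩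

theorem IsStablePartition.agreeOff_iff {P Q : Multiset (Finset V)} (hP : IsStablePartition G k P)
    (hQ : IsStablePartition G k Q) (v : V) :
    CliqueSetoid.AgreeOff v hP.toCliqueSetoid hQ.toCliqueSetoid ↔
      removeVertex P v = removeVertex Q v := by
  constructor
  · intro h
    refine eq_of_related_iff ?_ (fun a => ?_) (fun a => ?_) fun a b => ?_
    · rw [removeVertex, removeVertex, Multiset.card_map, Multiset.card_map, hP.card_eq, hQ.card_eq]
    · exact (countP_removeVertex_le P v a).trans (hP.partition a).le
    · exact (countP_removeVertex_le Q v a).trans (hQ.partition a).le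
    · rw [related_removeVertex, related_removeVertex]
      exact and_congr_right fun ha => and_congr_right fun hb => h a b ha hb
  · intro h a b ha hb
    have key : Related (removeVertex P v) a b ↔ Related (removeVertex Q v) a b := by rw [h]
    rw [related_removeVertex, related_removeVertex] at key
    simp only [ne_eq, ha, hb, not_false_eq_true, true_and] at key
    exact key

theorem exists_isStablePartition_toCliqueSetoid_eq [Fintype V] (r : CliqueSetoid Gᶜ) :
    ∃ (P : Multiset (Finset V)) (h : IsStablePartition G (Fintype.card V) P),
      h.toCliqueSetoid = r := by
  classical
  let cls : V → Finset V := fun a => {b | r.1 a b}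
  have mem_cls : ∀ a b, b ∈ cls a ↔ r.1 a b := fun a b => by simp [cls]
  have cls_eq : ∀ a b, r.1 a b → cls a = cls b := fun a b hab => by
    ext c
    rw [mem_cls, mem_cls]
    exact ⟨r.1.trans (r.1.symm hab), r.1.trans hab⟩
  let S : Finset (Finset V) := Finset.univ.image cls
  -- There are at most as many classes as vertices, so padding with empty sets gives exactly
  -- `Fintype.card V` parts.
  let P : Multiset (Finset V) := S.val + Multiset.replicate (Fintype.card V - S.card) ∅
  have hle : S.card ≤ Fintype.card V := Finset.card_image_le
  have mem_P : ∀ A a, a ∈ A → (A ∈ P ↔ A = cls a) := by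
    intro A a ha
    constructor
    · intro hA
      rcases Multiset.mem_add.1 hA with hA | hA
      · obtain ⟨b, -, rfl⟩ := Finset.mem_image.1 (Finset.mem_def.2 hA)
        exact cls_eq b a ((mem_cls b a).1 ha)
      · rw [Multiset.eq_of_mem_replicate hA] at ha
        exact absurd ha (Finset.notMem_empty a)
    · rintro rfl
      exact Multiset.mem_add.2 (Or.inl (Finset.mem_image_of_mem cls (Finset.mem_univ a)))
  have hrel : ∀ a b, Related P a b ↔ r.1 a b := by
    intro a b
    constructor
    · rintro ⟨A, hA, ha, hb⟩
      rwa [(mem_P A a ha).1 hA, mem_cls] at hb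
    · intro hab
      exact ⟨cls a, (mem_P _ a ((mem_cls a a).2 (r.1.refl a))).2 rfl,
        (mem_cls a a).2 (r.1.refl a), (mem_cls a b).2 hab⟩
  have hP : IsStablePartition G (Fintype.card V) P := by
    refine ⟨?_, ?_, ?_⟩
    · rw [Multiset.card_add, Multiset.card_replicate, Finset.card_val]
      omega
    · intro A hA a ha b hb hab
      exact ((SimpleGraph.compl_adj G a b).1 (r.2 a b ((hrel a b).1 ⟨A, hA, ha, hb⟩) hab)).2
    · intro v
      have h0 : (Multiset.replicate (Fintype.card V - S.card) (∅ : Finset V)).countP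
          (fun A => v ∈ A) = 0 :=
        Multiset.countP_eq_zero.2 fun A hA => by
          rw [Multiset.eq_of_mem_replicate hA]
          exact Finset.notMem_empty v
      have h1 : S.filter (fun A => v ∈ A) = {cls v} := by
        ext A
        rw [Finset.mem_filter, Finset.mem_singleton]
        constructor
        · rintro ⟨hA, hv⟩
          exact (mem_P A v hv).1 (Multiset.mem_add.2 (Or.inl hA))
        · rintro rfl
          exact ⟨Finset.mem_image_of_mem cls (Finset.mem_univ v), (mem_cls v v).2 (r.1.refl v)⟩
      have h2 := congrArg Finset.card h1
      rw [Finset.card_singleton, Finset.card, Finset.filter_val] at h2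
      rw [Multiset.countP_add, h0, add_zero, Multiset.countP_eq_card_filter]
      exact h2
  exact ⟨P, hP, Subtype.ext (Setoid.ext hrel)⟩

/-- The vertices of the Bell coloring multigraph, for as many parts as vertices, are the
partitions into cliques of the complement. -/
noncomputable def vertexSetEquiv [Fintype V] (G : SimpleGraph V) :
    (bellMultigraph (Fintype.card V) G).vertexSet ≃ CliqueSetoid Gᶜ :=
  Equiv.ofBijective
    (fun P => IsStablePartition.toCliqueSetoid (G := G) (k := Fintype.card V) P.2) <| by
    constructor
    · intro P Q hPQ
      have hP : IsStablePartition G _ P.1 := P.2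
      have hQ : IsStablePartition G _ Q.1 := Q.2
      refine Subtype.ext (eq_of_related_iff (hP.card_eq.trans hQ.card_eq.symm)
        (fun a => (hP.partition a).le) (fun a => (hQ.partition a).le) fun a b => ?_)
      have := congrArg (fun r : CliqueSetoid Gᶜ => r.1 a b) hPQ
      exact iff_of_eq this
    · intro r
      obtain ⟨P, hP, h⟩ := exists_isStablePartition_toCliqueSetoid_eq r
      exact ⟨⟨P, hP⟩, h⟩

variable [Fintype V]

theorem agreeOff_vertexSetEquiv {P Q : (bellMultigraph (Fintype.card V) G).vertexSet} {v : V} :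
    CliqueSetoid.AgreeOff v (vertexSetEquiv G P) (vertexSetEquiv G Q) ↔
      removeVertex P.1 v = removeVertex Q.1 v :=
  IsStablePartition.agreeOff_iff P.2 Q.2 v

theorem near_vertexSetEquiv_iff {P Q : (bellMultigraph (Fintype.card V) G).vertexSet} :
    CliqueSetoid.Near (vertexSetEquiv G P) (vertexSetEquiv G Q) ↔
      P = Q ∨ ∃ e : (bellMultigraph (Fintype.card V) G).edgeSet,
        (bellMultigraph (Fintype.card V) G).IsLink e P Q := by
  simp only [CliqueSetoid.Near, agreeOff_vertexSetEquiv, (vertexSetEquiv G).injective.eq_iff]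
  by_cases hPQ : P = Q
  · simp [hPQ]
  simp only [hPQ, false_or]
  constructor
  · rintro ⟨v, hv⟩
    have hl : (bellMultigraph (Fintype.card V) G).IsLink (s(P.1, Q.1), v) P Q :=
      ⟨rfl, P.2, Q.2, fun h => hPQ (Subtype.ext h), hv⟩
    exact ⟨⟨_, hl.edge_mem⟩, hl⟩
  · rintro ⟨e, -, -, -, -, he⟩
    exact ⟨_, he⟩

/-- Distinct edges with the same ends differ in their vertex label. -/
theorem double_vertexSetEquiv_iff {P Q : (bellMultigraph (Fintype.card V) G).vertexSet} :
    CliqueSetoid.Double (vertexSetEquiv G P) (vertexSetEquiv G Q) ↔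
      ∃ e f : (bellMultigraph (Fintype.card V) G).edgeSet, e ≠ f ∧
        (bellMultigraph (Fintype.card V) G).IsLink e P Q ∧
        (bellMultigraph (Fintype.card V) G).IsLink f P Q := by
  simp only [CliqueSetoid.Double, agreeOff_vertexSetEquiv, ne_eq,
    (vertexSetEquiv G).injective.eq_iff]
  constructor
  · rintro ⟨hPQ, v, w, hvw, hv, hw⟩
    have hl : ∀ v, removeVertex P.1 v = removeVertex Q.1 v →
        (bellMultigraph (Fintype.card V) G).IsLink (s(P.1, Q.1), v) P Q := fun v hv =>
      ⟨rfl, P.2, Q.2, fun h => hPQ (Subtype.ext h), hv⟩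
    exact ⟨⟨_, (hl v hv).edge_mem⟩, ⟨_, (hl w hw).edge_mem⟩,
      fun h => hvw (congrArg (fun e => e.1.2) h), hl v hv, hl w hw⟩
  · rintro ⟨e, f, hef, ⟨he, -, -, hne, hv⟩, ⟨hf, -, -, -, hw⟩⟩
    exact ⟨fun h => hne (congrArg _ h), e.1.2, f.1.2,
      fun h => hef (Subtype.ext (Prod.ext (he.trans hf.symm) h)), hv, hw⟩

/-- This identifies the vertices of the core with the domain of the isomorphism from
`exists_support_equiv`. -/
theorem mem_compl_universalVerts_iff {V : Type*} {G : SimpleGraph V} {v : V} :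
    v ∈ G.universalVertsᶜ ↔ (star Gᶜ v).Nonempty := by
  have h : v ∈ G.universalVertsᶜ ↔ ∃ w, v ≠ w ∧ ¬G.Adj v w := by
    simp [SimpleGraph.universalVerts, SimpleGraph.IsUniversal]
  rw [h]
  constructor
  · rintro ⟨w, hvw, h⟩
    exact ⟨⟨s(v, w), (SimpleGraph.compl_adj G v w).2 ⟨hvw, h⟩⟩, Sym2.mem_mk_left v w⟩
  · rintro ⟨⟨e, he⟩, w, rfl⟩
    obtain ⟨hvw, h⟩ := (SimpleGraph.compl_adj G v w).1 he
    exact ⟨w, hvw, h⟩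

end StablePartitions

end BellColoring

theorem mainTheorem5 {V₁ : Type*} {V₂ : Type*} [Fintype V₁] [Fintype V₂]
    [DecidableEq V₁] [DecidableEq V₂] (G₁ : SimpleGraph V₁) (G₂ : SimpleGraph V₂) (n₁ n₂ : ℕ)
    (hn₁ : n₁ = Fintype.card V₁) (hn₂ : n₂ = Fintype.card V₂)
    (hiso : Nonempty (BellColoring.MultigraphIso
      (BellColoring.bellMultigraph n₁ G₁) (BellColoring.bellMultigraph n₂ G₂))) :
    Nonempty (BellColoring.core G₁ ≃g BellColoring.core G₂) := by
  open BellColoring in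
  subst hn₁ hn₂
  obtain ⟨I⟩ := hiso
  let φ : CliqueSetoid G₁ᶜ ≃ CliqueSetoid G₂ᶜ :=
    (vertexSetEquiv G₁).symm.trans (I.vertexEquiv.trans (vertexSetEquiv G₂))
  have hφ : ∀ P, φ (vertexSetEquiv G₁ P) = vertexSetEquiv G₂ (I.vertexEquiv P) := fun P => by
    simp [φ]
  obtain ⟨ψ, hψ⟩ := CliqueSetoid.exists_edge_equiv φ
    (fun P Q => by
      obtain ⟨P, rfl⟩ := (vertexSetEquiv G₁).surjective P
      obtain ⟨Q, rfl⟩ := (vertexSetEquiv G₁).surjective Q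
      simp only [hφ, near_vertexSetEquiv_iff, I.vertexEquiv.injective.eq_iff,
        I.edgeEquiv.surjective.exists, I.isLink_iff])
    (fun P Q => by
      obtain ⟨P, rfl⟩ := (vertexSetEquiv G₁).surjective P
      obtain ⟨Q, rfl⟩ := (vertexSetEquiv G₁).surjective Q
      simp only [hφ, double_vertexSetEquiv_iff, I.edgeEquiv.surjective.exists, I.isLink_iff,
        ne_eq, I.edgeEquiv.injective.eq_iff])
  obtain ⟨F, hF⟩ := exists_support_equiv ψ hψ
  let F' : ↥(G₁.universalVertsᶜ) ≃ ↥(G₂.universalVertsᶜ) :=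
    (Equiv.subtypeEquivRight fun _ => mem_compl_universalVerts_iff).trans
      (F.trans (Equiv.subtypeEquivRight fun _ => mem_compl_universalVerts_iff).symm)
  refine ⟨⟨F', fun {a b} => ?_⟩⟩
  have h := hF ⟨a, mem_compl_universalVerts_iff.1 a.2⟩ ⟨b, mem_compl_universalVerts_iff.1 b.2⟩
  change G₂ᶜ.Adj (F' a) (F' b) ↔ G₁ᶜ.Adj a b at h
  change G₂.Adj (F' a) (F' b) ↔ G₁.Adj a b
  rw [SimpleGraph.compl_adj, SimpleGraph.compl_adj] at h
  by_cases hab : a = b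
  · subst hab
    simp
  · have h1 : (a : V₁) ≠ b := fun h => hab (Subtype.ext h)
    have h2 : (F' a : V₂) ≠ F' b := fun h => hab (F'.injective (Subtype.ext h))
    simpa [h1, h2, not_iff_not] using h
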